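/- Let $X$ be a nonempty smooth compact Riemannian manifold without boundary of dimension $d\ge 1$, with Riemannian distance $\operatorname{dist}$ (equal to $+\infty$ between different components, if $X$ is disconnected) and Riemannian volume $dx$ normalized so that $dx(X)=1$. For positive finite Borel measures $\mu,\nu$ on $X$ of equal mass put $$W_1(\mu,\nu)=\inf_{\pi}\int_{X\times X}\operatorname{dist}(x,y)\,d\pi(x,y),$$ the infimum being over all positive measures $\pi$ on $X\times X$ with marginals $\mu$ and $\nu$; for arbitrary positive finite Borel measures $\mu,\nu$ put $$W_1^{1,1}(\mu,\nu)=\inf_{\tilde\mu,\tilde\nu}\;|\mu-\tilde\mu|+|\nu-\tilde\nu|+W_1(\tilde\mu,\tilde\nu),$$ the infimum being over all positive finite Borel measures $\tilde\mu,\tilde\nu$ of equal mass, where $|\sigma|=\sigma_+(X)+\sigma_-(X)$ is the total mass of a signed measure with Jordan decomposition $\sigma=\sigma_+-\sigma_-$; and for signed finite Borel measures $\mu,\nu$ put $$\mathbf W_1^{1,1}(\mu,\nu)=W_1^{1,1}(\mu_++\nu_-,\;\mu_-+\nu_+).$$ Then there is a constant $c>0$, depending only on $X$, such that for every $N\ge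 1$ and all points $z_1,\dots,z_N\in X$ $$W_1\Big(\frac1N\sum_{i=1}^N\delta_{z_i},\,dx\Big)\ \ge\ \frac{c}{N^{1/d}},$$ and, with the same $c$, for all integers $N_1,N_2\ge 0$ with $N_1+N_2\ge 1$ and all points $x_1,\dots,x_{N_1},y_1,\dots,y_{N_2}\in X$ $$\mathbf W_1^{1,1}\Big(\frac{1}{N_1+N_2}\Big[\sum_{i=1}^{N_1}\delta_{x_i}-\sum_{j=1}^{N_2}\delta_{y_j}\Big],\,dx\Big)\ \ge\ \frac{c}{(N_1+N_2)^{1/d}}-\frac{2N_2}{N_1+N_2}.$$ -/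

import Mathlib

open MeasureTheory Manifold Bundle
open scoped ENNReal ContDiff

noncomputable section

namespace SignedTransport

section Volume

variable {d : ℕ} (M : Type*) [EMetricSpace M] [ChartedSpace (EuclideanSpace ℝ (Fin d)) M]
  [IsManifold (𝓡 d) ∞ M] [RiemannianBundle (fun x : M => TangentSpace (𝓡 d) x)]

variable {M} in
/-- The coordinate vector field `∂ᵢ` of the chart at `p`, at the point with coordinates `y`. -/
def coordVector (p : M) (y : EuclideanSpace ℝ (Fin d)) (i : Fin d) :
    TangentSpace (𝓡 d) ((chartAt (EuclideanSpace ℝ (Fin d)) p).symm y) :=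
  mfderiv (𝓡 d) (𝓡 d) (chartAt (EuclideanSpace ℝ (Fin d)) p).symm y
    (EuclideanSpace.single i (1 : ℝ) : EuclideanSpace ℝ (Fin d))

variable {M} in
/-- The metric coefficients `gᵢⱼ = g(∂ᵢ, ∂ⱼ)` in the chart at `p`, at the coordinates `y`. -/
def metricCoeff (p : M) (y : EuclideanSpace ℝ (Fin d)) : Matrix (Fin d) (Fin d) ℝ :=
  Matrix.of fun i j => inner ℝ (coordVector p y i) (coordVector p y j)

variable [MeasurableSpace M]

variable {M} in
/-- The Riemannian volume on the domain of the chart at `p` (and zero off it): the push-forward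
to `M` of `√(det g) dy` on the image of the chart. -/
def chartVolume (p : M) : Measure M :=
  ((volume.restrict (chartAt (EuclideanSpace ℝ (Fin d)) p).target).withDensity
    (fun y => ENNReal.ofReal (Real.sqrt (metricCoeff p y).det))).map
      (chartAt (EuclideanSpace ℝ (Fin d)) p).symm

variable (d) in
/-- The Riemannian volume measure. The chart volumes agree on overlaps of chart domains, and the
volume is the measure that restricts to each of them, which is their least upper bound in the
lattice of measures. -/
def riemannianVolume : Measure M := ⨆ p : M, chartVolume (d := d) p

variable (d) in
/-- The normalized Riemannian volume measure `dx`. -/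
def normalizedVolume : Measure M :=
  (riemannianVolume d M Set.univ)⁻¹ • riemannianVolume d M

instance isFiniteMeasure_normalizedVolume : IsFiniteMeasure (normalizedVolume d M) where
  measure_univ_lt_top := by
    simp only [normalizedVolume, Measure.smul_apply, smul_eq_mul]
    exact lt_of_le_of_lt (ENNReal.inv_mul_le_one _) ENNReal.one_lt_top

end Volume

section Wasserstein

variable {M : Type*} [MeasurableSpace M]

/-- `γ` is a transference plan between `μ` and `ν`. -/
def IsTransferencePlan (γ : Measure (M × M)) (μ ν : Measure M) : Prop :=
  γ.fst = μ ∧ γ.snd = ν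

/-- The `1`-Wasserstein distance, for positive finite measures of the same mass. -/
def W₁ [EMetricSpace M] (μ ν : Measure M) : ℝ≥0∞ :=
  ⨅ (γ : Measure (M × M)) (_ : IsTransferencePlan γ μ ν), ∫⁻ z, edist z.1 z.2 ∂γ

/-- The total mass `|σ| = σ₊(M) + σ₋(M)` of a signed measure. -/
def totalMass (σ : SignedMeasure M) : ℝ≥0∞ := σ.totalVariation Set.univ

/-- The generalized Wasserstein distance `W₁^{1,1}` between positive finite measures. -/
def genW₁ [EMetricSpace M] (μ ν : FiniteMeasure M) : ℝ≥0∞ :=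
  ⨅ (μ' : FiniteMeasure M) (ν' : FiniteMeasure M) (_ : μ'.mass = ν'.mass),
    totalMass ((μ : Measure M).toSignedMeasure - (μ' : Measure M).toSignedMeasure)
      + totalMass ((ν : Measure M).toSignedMeasure - (ν' : Measure M).toSignedMeasure)
      + W₁ (μ' : Measure M) (ν' : Measure M)

/-- The positive part of the Jordan decomposition. -/
def posPart (σ : SignedMeasure M) : FiniteMeasure M :=
  ⟨σ.toJordanDecomposition.posPart, inferInstance⟩

/-- The negative part of the Jordan decomposition. -/
def negPart (σ : SignedMeasure M) : FiniteMeasure M :=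
  ⟨σ.toJordanDecomposition.negPart, inferInstance⟩

/-- The signed generalized Wasserstein distance
`𝐖₁^{1,1}(μ, ν) = W₁^{1,1}(μ₊ + ν₋, μ₋ + ν₊)`. -/
def signedW₁ [EMetricSpace M] (μ ν : SignedMeasure M) : ℝ≥0∞ :=
  genW₁ (posPart μ + negPart ν) (negPart μ + posPart ν)

/-- The empirical measure `(1/N) ∑ δ_{z_i}`. -/
def empirical {N : ℕ} (z : Fin N → M) : Measure M :=
  (N : ℝ≥0∞)⁻¹ • ∑ i, Measure.dirac (z i)

/-- The signed measure `(∑ δ_{x_i} - ∑ δ_{y_j}) / (N₁ + N₂)`. -/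
def signedEmpirical {N₁ N₂ : ℕ} (x : Fin N₁ → M) (y : Fin N₂ → M) : SignedMeasure M :=
  (1 / ((N₁ : ℝ) + (N₂ : ℝ))) •
    (∑ i, (Measure.dirac (x i)).toSignedMeasure - ∑ j, (Measure.dirac (y j)).toSignedMeasure)

end Wasserstein

end SignedTransport

end

open scoped NNReal Topology

/-! Take `f = min(dist(·, S), r)` with `S` the set of positive atoms. It is 1-Lipschitz and vanishes
on `S`, so weak duality gives `W₁ ≥ ∫ f dx`. If balls of radius `r` have volume at most `C r^d` and
`2 C N r^d = 1`, the balls about `S` fill at most half of the space; `f = r` elsewhere, so the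
integral is at least `r / 2`, of order `N^(-1/d)` (`exists_lintegral_truncInfEDist_ge`). For the
signed distance, `f ≤ r ≤ 1` makes changing a measure cost no more than the total mass changed
(`lintegral_le_lintegral_add_genW₁`). The positive part lives on the `x_i`, and the other measure
dominates `dx`, so the same integral is a lower bound. The ball growth
(`exists_normalizedVolume_eball_le`) follows by compactness from local facts: charts are Lipschitz,
their volume densities are bounded, and one chart volume dominates the supremum on its domain. -/

namespace SignedTransport

/-! ### Lower bounds for transport costs by Lipschitz test functions -/

section Duality

variable {M : Type*} [MeasurableSpace M]

/-- Weak Kantorovich duality: a nonnegative `1`-Lipschitz function bounds `W₁` from below. -/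
theorem lintegral_le_lintegral_add_W₁ [EMetricSpace M] {μ ν : Measure M} {f : M → ℝ≥0∞}
    (hf : Measurable f) (hlip : ∀ x y, f y ≤ f x + edist x y) :
    ∫⁻ x, f x ∂ν ≤ ∫⁻ x, f x ∂μ + W₁ μ ν := by
  rw [W₁, ENNReal.add_iInf]
  refine le_iInf fun γ => ?_
  by_cases hγ : IsTransferencePlan γ μ ν
  · obtain ⟨rfl, rfl⟩ := hγ
    have h1 : IsTransferencePlan γ γ.fst γ.snd := ⟨rfl, rfl⟩
    simp only [h1, iInf_pos]
    rw [Measure.fst, Measure.snd, lintegral_map hf measurable_fst, lintegral_map hf measurable_snd,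
      ← lintegral_add_left (f := fun z : M × M => f z.1) (hf.comp measurable_fst)]
    exact lintegral_mono fun z => hlip z.1 z.2
  · simp [hγ]

/-- With `σ = μ - ν`, the Jordan decomposition reads `σ₊ + ν = μ + σ₋`, free of subtraction; drop
`σ₋` and enlarge `σ₊` to `|σ|`. -/
theorem le_add_totalVariation (μ ν : Measure M) [IsFiniteMeasure μ] [IsFiniteMeasure ν] :
    μ ≤ ν + (μ.toSignedMeasure - ν.toSignedMeasure).totalVariation := by
  set σ := μ.toSignedMeasure - ν.toSignedMeasure with hσ
  have h := σ.toSignedMeasure_toJordanDecomposition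
  rw [JordanDecomposition.toSignedMeasure, hσ, ← hσ, sub_eq_sub_iff_add_eq_add] at h
  have h2 : σ.toJordanDecomposition.posPart + ν = μ + σ.toJordanDecomposition.negPart := by
    rw [← Measure.toSignedMeasure_eq_toSignedMeasure_iff]
    simpa [Measure.toSignedMeasure_add] using h
  calc μ ≤ μ + σ.toJordanDecomposition.negPart := Measure.le_add_right le_rfl
    _ = ν + σ.toJordanDecomposition.posPart := by rw [← h2, add_comm]
    _ ≤ ν + σ.totalVariation := by
      gcongr
      exact Measure.le_add_right le_rfl

theorem totalVariation_sub_comm (σ τ : SignedMeasure M) :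
    (σ - τ).totalVariation = (τ - σ).totalVariation := by
  rw [← neg_sub τ σ, SignedMeasure.totalVariation_neg]

theorem lintegral_le_lintegral_add_totalMass (μ ν : Measure M) [IsFiniteMeasure μ]
    [IsFiniteMeasure ν] {f : M → ℝ≥0∞} (hf : ∀ x, f x ≤ 1) :
    ∫⁻ x, f x ∂μ ≤ ∫⁻ x, f x ∂ν + totalMass (μ.toSignedMeasure - ν.toSignedMeasure) := by
  refine (lintegral_mono' (le_add_totalVariation μ ν) le_rfl).trans ?_
  rw [lintegral_add_measure]
  gcongr
  refine (lintegral_mono hf).trans ?_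
  simp [totalMass]

/-- A nonnegative `1`-Lipschitz function bounded by `1` bounds `W₁^{1,1}` from below. -/
theorem lintegral_le_lintegral_add_genW₁ [EMetricSpace M] (μ ν : FiniteMeasure M) {f : M → ℝ≥0∞}
    (hf : Measurable f) (hlip : ∀ x y, f y ≤ f x + edist x y) (hf1 : ∀ x, f x ≤ 1) :
    ∫⁻ x, f x ∂(ν : Measure M) ≤ ∫⁻ x, f x ∂(μ : Measure M) + genW₁ μ ν := by
  rw [genW₁]
  simp only [ENNReal.add_iInf]
  refine le_iInf fun μ' => le_iInf fun ν' => ?_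
  by_cases h : μ'.mass = ν'.mass
  · simp only [h, iInf_pos]
    have h1 := lintegral_le_lintegral_add_totalMass (ν : Measure M) (ν' : Measure M) hf1
    have h2 := lintegral_le_lintegral_add_W₁ (μ := (μ' : Measure M)) (ν := (ν' : Measure M)) hf hlip
    have h3 := lintegral_le_lintegral_add_totalMass (μ' : Measure M) (μ : Measure M) hf1
    have h4 : totalMass ((μ' : Measure M).toSignedMeasure - (μ : Measure M).toSignedMeasure) =
        totalMass ((μ : Measure M).toSignedMeasure - (μ' : Measure M).toSignedMeasure) := by
      rw [totalMass, totalVariation_sub_comm, totalMass]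
    rw [h4] at h3
    refine h1.trans ((add_le_add_left (h2.trans (add_le_add_left h3 _)) _).trans (le_of_eq ?_))
    ring
  · simp [h]

theorem posPart_toSignedMeasure (μ : Measure M) [IsFiniteMeasure μ] :
    (posPart μ.toSignedMeasure : Measure M) = μ ∧ negPart μ.toSignedMeasure = 0 := by
  let j : JordanDecomposition M := ⟨μ, 0, Measure.MutuallySingular.zero_right⟩
  have hj : μ.toSignedMeasure.toJordanDecomposition = j := by
    apply SignedMeasure.toJordanDecomposition_eq
    simp [JordanDecomposition.toSignedMeasure, j]
  simp only [posPart, negPart, hj]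
  exact ⟨rfl, rfl⟩

theorem posPart_apply_eq_zero (σ : SignedMeasure M) {s : Set M} (hs : MeasurableSet s)
    (h : ∀ t ⊆ s, MeasurableSet t → σ t ≤ 0) : (posPart σ : Measure M) s = 0 := by
  obtain ⟨i, hi, hpos, _, hp, _⟩ := σ.toJordanDecomposition_spec
  change σ.toJordanDecomposition.posPart s = 0
  -- On the positive Hahn set `i`, the positive part of `s` is `σ (i ∩ s)`, which is both `≥ 0` and
  -- `≤ 0`.
  rw [hp, SignedMeasure.toMeasureOfZeroLE_apply σ hpos hi hs]
  have h1 := h (i ∩ s) Set.inter_subset_right (hi.inter hs)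
  have h2 := σ.nonneg_of_zero_le_restrict (σ.zero_le_restrict_subset hi Set.inter_subset_left hpos)
    (i := i ∩ s)
  have h3 : σ (i ∩ s) = 0 := le_antisymm h1 h2
  exact ENNReal.coe_eq_zero.2 (NNReal.coe_eq_zero.1 h3)

theorem signedEmpirical_apply {N₁ N₂ : ℕ} (x : Fin N₁ → M) (y : Fin N₂ → M) {s : Set M}
    (hs : MeasurableSet s) : signedEmpirical x y s = (1 / ((N₁ : ℝ) + (N₂ : ℝ))) *
      (∑ i, (Measure.dirac (x i)).real s - ∑ j, (Measure.dirac (y j)).real s) := by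
  have key : ∀ {n : ℕ} (w : Fin n → M), (∑ i, (Measure.dirac (w i)).toSignedMeasure) s =
      ∑ i, (Measure.dirac (w i)).real s := by
    intro n w
    rw [← FunLike.coeAddMonoidHom_apply, map_sum, Finset.sum_apply]
    simp [Measure.toSignedMeasure_apply_measurable hs]
  simp only [signedEmpirical, _root_.smul_apply, _root_.sub_apply, key, smul_eq_mul]

/-- Away from the `x_i` only negative atoms remain. Cancellation when some `x_i = y_j` is harmless,
since the exact positive part is never needed. -/
theorem posPart_signedEmpirical_compl_range [MeasurableSingletonClass M] {N₁ N₂ : ℕ}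
    (x : Fin N₁ → M) (y : Fin N₂ → M) :
    (posPart (signedEmpirical x y) : Measure M) (Set.range x)ᶜ = 0 := by
  refine posPart_apply_eq_zero _ (Set.finite_range x).measurableSet.compl fun t ht hmt => ?_
  rw [signedEmpirical_apply x y hmt]
  have h0 : ∑ i, (Measure.dirac (x i)).real t = 0 := by
    refine Finset.sum_eq_zero fun i _ => ?_
    have : x i ∉ t := fun h => ht h ⟨i, rfl⟩
    simp [Measure.real, Measure.dirac_apply' _ hmt, this]
  rw [h0]
  refine mul_nonpos_of_nonneg_of_nonpos (by positivity) ?_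
  simp only [zero_sub, Left.neg_nonpos_iff]
  exact Finset.sum_nonneg fun _ _ => measureReal_nonneg

end Duality

/-! ### Quantization bound under ball growth -/

section Lower

variable {M : Type*} [EMetricSpace M]

/-- The distance to a set, truncated at `r`. -/
noncomputable def truncInfEDist (s : Set M) (r : ℝ≥0∞) (x : M) : ℝ≥0∞ :=
  min (Metric.infEDist x s) r

theorem truncInfEDist_le_add (s : Set M) (r : ℝ≥0∞) (x y : M) :
    truncInfEDist s r y ≤ truncInfEDist s r x + edist x y := by
  rw [truncInfEDist, truncInfEDist, min_add]
  exact min_le_min (by rw [edist_comm]; exact Metric.infEDist_le_infEDist_add_edist) le_self_add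

theorem truncInfEDist_eq_zero {s : Set M} {r : ℝ≥0∞} {x : M} (hx : x ∈ s) :
    truncInfEDist s r x = 0 := by
  simp [truncInfEDist, Metric.infEDist_zero_of_mem hx]

variable [MeasurableSpace M]

theorem measurable_truncInfEDist [BorelSpace M] (s : Set M) (r : ℝ≥0∞) :
    Measurable (truncInfEDist s r) :=
  measurable_infEDist.min measurable_const

theorem lintegral_truncInfEDist_eq_zero {s : Set M} {r : ℝ≥0∞} {μ : Measure M} (h : μ sᶜ = 0) :
    ∫⁻ x, truncInfEDist s r x ∂μ = 0 := by
  have : ∀ᵐ x ∂μ, truncInfEDist s r x = 0 := by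
    filter_upwards [mem_ae_iff.2 h] with x hx using truncInfEDist_eq_zero hx
  simp [lintegral_congr_ae this]

/-- Off the union of the balls the integrand equals `r`, and a union bound controls what is left
out. With no points the distance is `⊤` and the integrand is `r` everywhere. -/
theorem mul_le_lintegral_truncInfEDist [BorelSpace M] {ι : Type*} [Fintype ι] (z : ι → M)
    {r ε : ℝ≥0∞} {μ : Measure M} [IsProbabilityMeasure μ] (h : ∀ i, μ (Metric.eball (z i) r) ≤ ε) :
    r * (1 - Fintype.card ι * ε) ≤ ∫⁻ x, truncInfEDist (Set.range z) r x ∂μ := by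
  set A : Set M := ⋃ i, Metric.eball (z i) r
  have hA : MeasurableSet A := .iUnion fun i => Metric.isOpen_eball.measurableSet
  have hμ : μ A ≤ Fintype.card ι * ε := by
    refine (measure_iUnion_fintype_le μ _).trans ((Finset.sum_le_sum fun i _ => h i).trans ?_)
    simp
  calc r * (1 - Fintype.card ι * ε) ≤ r * μ Aᶜ := by
        rw [prob_compl_eq_one_sub hA]
        gcongr
    _ = ∫⁻ x in Aᶜ, r ∂μ := by simp
    _ ≤ ∫⁻ x in Aᶜ, truncInfEDist (Set.range z) r x ∂μ := by
        refine setLIntegral_mono' hA.compl fun x hx => le_min ?_ le_rfl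
        rw [Metric.le_infEDist]
        rintro _ ⟨i, rfl⟩
        by_contra! hlt
        exact hx (Set.mem_iUnion.2 ⟨i, hlt⟩)
    _ ≤ _ := setLIntegral_le_lintegral _ _

/-- A quantization bound: if balls have measure at most `C r ^ d`, the integral of the distance to
`n ≤ N` points, truncated at a suitable `r ≤ 1`, is at least a multiple of `N ^ (-1 / d)`. -/
theorem exists_lintegral_truncInfEDist_ge [BorelSpace M] {d : ℕ} (hd : 1 ≤ d) {μ : Measure M}
    [IsProbabilityMeasure μ] {C : ℝ} (hC : 1 ≤ C)
    (hball : ∀ x : M, ∀ r : ℝ, 0 < r → μ (Metric.eball x (ENNReal.ofReal r)) ≤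
      ENNReal.ofReal (C * r ^ d)) {n N : ℕ} (hn : n ≤ N) (hN : 0 < N) (z : Fin n → M) :
    ∃ r : ℝ≥0∞, r ≤ 1 ∧
      ENNReal.ofReal ((2 * C) ^ (-1 / (d : ℝ)) / 2 / (N : ℝ) ^ (1 / (d : ℝ))) ≤
        ∫⁻ x, truncInfEDist (Set.range z) r x ∂μ := by
  have hd0 : (d : ℝ) ≠ 0 := by positivity
  have hN1 : (1 : ℝ) ≤ N := by exact_mod_cast hN
  have hB : 1 ≤ 2 * C * N := by nlinarith
  -- Chosen so that `N` balls of measure `C r^d` have total mass `1/2`; `C ≥ 1` gives `r ≤ 1`.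
  set r : ℝ := (2 * C * N) ^ (-1 / (d : ℝ)) with hr
  have hr0 : 0 < r := by positivity
  have hr1 : r ≤ 1 := Real.rpow_le_one_of_one_le_of_nonpos hB (by
    rw [neg_div]; exact neg_nonpos.2 (by positivity))
  have hrd : r ^ d = (2 * C * N)⁻¹ := by
    rw [hr, ← Real.rpow_natCast, ← Real.rpow_mul (by positivity), div_mul_cancel₀ _ hd0,
      Real.rpow_neg_one]
  have hr' : r = (2 * C) ^ (-1 / (d : ℝ)) / (N : ℝ) ^ (1 / (d : ℝ)) := by
    rw [hr, Real.mul_rpow (by positivity) (by positivity), neg_div,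
      Real.rpow_neg (by positivity : (0 : ℝ) ≤ N), ← div_eq_mul_inv]
  refine ⟨ENNReal.ofReal r, by simpa using hr1, ?_⟩
  refine le_trans ?_ (mul_le_lintegral_truncInfEDist z fun i => hball (z i) r hr0)
  have h1 : (Fintype.card (Fin n) : ℝ≥0∞) * ENNReal.ofReal (C * r ^ d) ≤ ENNReal.ofReal (1 / 2) := by
    rw [Fintype.card_fin, ← ENNReal.ofReal_natCast, ← ENNReal.ofReal_mul (by positivity), hrd]
    refine ENNReal.ofReal_le_ofReal ?_
    have hnN : (n : ℝ) ≤ N := by exact_mod_cast hn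
    rw [show (n : ℝ) * (C * (2 * C * N)⁻¹) = (n / N) * (1 / 2) by field_simp]
    have := div_le_one_of_le₀ hnN (by positivity)
    linarith
  calc ENNReal.ofReal ((2 * C) ^ (-1 / (d : ℝ)) / 2 / (N : ℝ) ^ (1 / (d : ℝ)))
      = ENNReal.ofReal r * ENNReal.ofReal (1 / 2) := by
        rw [← ENNReal.ofReal_mul hr0.le, hr']
        congr 1
        ring
    _ = ENNReal.ofReal r * (1 - ENNReal.ofReal (1 / 2)) := by
        rw [← ENNReal.ofReal_one, ← ENNReal.ofReal_sub _ (by norm_num)]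
        norm_num
    _ ≤ _ := by gcongr

theorem empirical_compl_range {N : ℕ} [BorelSpace M] (z : Fin N → M) :
    empirical z (Set.range z)ᶜ = 0 := by
  have hm : MeasurableSet (Set.range z)ᶜ := (Set.finite_range z).measurableSet.compl
  simp [empirical, Measure.dirac_apply' _ hm]

/-- The lower bounds on transport distances for a probability measure with a ball growth bound. -/
theorem exists_transport_lower_bound [BorelSpace M] {d : ℕ} (hd : 1 ≤ d) {μ : Measure M}
    [IsProbabilityMeasure μ] {C : ℝ} (hC : 1 ≤ C)
    (hball : ∀ x : M, ∀ r : ℝ, 0 < r → μ (Metric.eball x (ENNReal.ofReal r)) ≤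
      ENNReal.ofReal (C * r ^ d)) :
    ∃ c : ℝ, 0 < c ∧
      (∀ (N : ℕ), 0 < N → ∀ z : Fin N → M,
        ENNReal.ofReal (c / (N : ℝ) ^ (1 / (d : ℝ))) ≤ W₁ (empirical z) μ) ∧
      (∀ (N₁ N₂ : ℕ), 0 < N₁ + N₂ → ∀ (x : Fin N₁ → M) (y : Fin N₂ → M),
        ENNReal.ofReal (c / ((N₁ : ℝ) + (N₂ : ℝ)) ^ (1 / (d : ℝ))
            - 2 * (N₂ : ℝ) / ((N₁ : ℝ) + (N₂ : ℝ))) ≤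
          signedW₁ (signedEmpirical x y) μ.toSignedMeasure) := by
  refine ⟨(2 * C) ^ (-1 / (d : ℝ)) / 2, by positivity, fun N hN z => ?_, fun N₁ N₂ hN x y => ?_⟩
  · obtain ⟨r, -, hr⟩ := exists_lintegral_truncInfEDist_ge hd hC hball le_rfl hN z
    refine hr.trans ((lintegral_le_lintegral_add_W₁ (μ := empirical z)
      (measurable_truncInfEDist _ r)
      (truncInfEDist_le_add _ r)).trans (le_of_eq ?_))
    rw [lintegral_truncInfEDist_eq_zero (empirical_compl_range z), zero_add]
  -- Only the `N₁` positive points enter the test function, while the radius is tuned to `N₁ + N₂`.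
  · obtain ⟨r, hr1, hr⟩ := exists_lintegral_truncInfEDist_ge hd hC hball
      (Nat.le_add_right N₁ N₂) hN x
    rw [Nat.cast_add] at hr
    have hsub : ∀ a : ℝ, a - 2 * (N₂ : ℝ) / ((N₁ : ℝ) + (N₂ : ℝ)) ≤ a := fun a =>
      sub_le_self _ (by positivity)
    -- The bound holds even without the subtracted term, which is discarded here.
    refine (ENNReal.ofReal_le_ofReal (hsub _)).trans (hr.trans ?_)
    obtain ⟨hp, hn⟩ := posPart_toSignedMeasure μ
    rw [signedW₁, hn, add_zero]
    have key := lintegral_le_lintegral_add_genW₁ (posPart (signedEmpirical x y))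
      (negPart (signedEmpirical x y) + posPart μ.toSignedMeasure)
      (measurable_truncInfEDist (Set.range x) r) (truncInfEDist_le_add _ r)
      (fun w => (min_le_right _ _).trans hr1)
    rw [lintegral_truncInfEDist_eq_zero (posPart_signedEmpirical_compl_range x y), zero_add] at key
    refine le_trans (lintegral_mono' ?_ le_rfl) key
    rw [FiniteMeasure.toMeasure_add, hp]
    exact Measure.le_add_left le_rfl

end Lower

/-! ### Charts are locally Lipschitz for the Riemannian distance -/

section Riemannian

variable {d : ℕ} {M : Type*} [EMetricSpace M] [ChartedSpace (EuclideanSpace ℝ (Fin d)) M]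
  [IsManifold (𝓡 d) ∞ M] [RiemannianBundle (fun x : M => TangentSpace (𝓡 d) x)]
  [IsContMDiffRiemannianBundle (𝓡 d) ∞ (EuclideanSpace ℝ (Fin d))
      (fun x : M => TangentSpace (𝓡 d) x)]

instance isContinuousRiemannianBundle_tangentSpace :
    IsContinuousRiemannianBundle (EuclideanSpace ℝ (Fin d))
      (fun x : M => TangentSpace (𝓡 d) x) := by
  obtain ⟨g, hg, h⟩ := IsContMDiffRiemannianBundle.exists_contMDiff (IB := 𝓡 d) (n := ∞)
    (F := EuclideanSpace ℝ (Fin d)) (E := fun x : M => TangentSpace (𝓡 d) x)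
  exact ⟨g, hg.continuous, h⟩

/-- Near `x`, the derivative of the chart at `x` is bounded for the Riemannian norm. -/
theorem eventually_enorm_mfderiv_chartAt_le (x : M) :
    ∃ C : ℝ≥0, ∀ᶠ y in 𝓝 x, ∀ v : TangentSpace (𝓡 d) y,
      @enorm (EuclideanSpace ℝ (Fin d)) _
        (mfderiv (𝓡 d) (𝓡 d) (chartAt (EuclideanSpace ℝ (Fin d)) x) y v) ≤ C * ‖v‖ₑ := by
  obtain ⟨C, -, hC⟩ := eventually_enorm_mfderiv_extChartAt_lt (𝓡 d) x
  refine ⟨C, hC.mono fun y hy v => ?_⟩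
  let _ := normedAddCommGroupTangentSpaceVectorSpace (E := EuclideanSpace ℝ (Fin d)) (extChartAt (𝓡 d) x y)
  let _ := normedSpaceTangentSpaceVectorSpace (E := EuclideanSpace ℝ (Fin d)) (extChartAt (𝓡 d) x y)
  have := (ContinuousLinearMap.le_opENorm (mfderiv (𝓡 d) (𝓡 d) (extChartAt (𝓡 d) x) y) v)
  exact this.trans (mul_le_mul_left hy.le _)

/-- Near the image of `x`, the derivative of the inverse chart at `x` is bounded for the
Riemannian norm. -/
theorem eventually_enorm_mfderiv_chartAt_symm_le (x : M) :
    ∃ C : ℝ≥0, ∀ᶠ y in 𝓝 (chartAt (EuclideanSpace ℝ (Fin d)) x x),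
      ∀ v : EuclideanSpace ℝ (Fin d),
      ‖mfderiv (𝓡 d) (𝓡 d) (chartAt (EuclideanSpace ℝ (Fin d)) x).symm y v‖ₑ ≤ C * ‖v‖ₑ := by
  obtain ⟨C, -, hC⟩ := eventually_enorm_mfderivWithin_symm_extChartAt_lt (𝓡 d) x
  simp only [modelWithCornersSelf_coe, Set.range_id, nhdsWithin_univ, mfderivWithin_univ] at hC
  refine ⟨C, hC.mono fun y hy v => ?_⟩
  let _ := normedAddCommGroupTangentSpaceVectorSpace (E := EuclideanSpace ℝ (Fin d)) y
  let _ := normedSpaceTangentSpaceVectorSpace (E := EuclideanSpace ℝ (Fin d)) y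
  have := (ContinuousLinearMap.le_opENorm (mfderiv (𝓡 d) (𝓡 d) (extChartAt (𝓡 d) x).symm y) v)
  exact this.trans (mul_le_mul_left hy.le _)

/-- The chart at `x₀` is Lipschitz near `x₀` for the Riemannian distance. -/
theorem exists_edist_chartAt_le [IsRiemannianManifold (𝓡 d) M] (x₀ : M) :
    ∃ C : ℝ≥0, ∃ ε : ℝ≥0∞, 0 < ε ∧ ∀ x ∈ Metric.eball x₀ ε, ∀ y, edist x y < ε →
      edist (chartAt (EuclideanSpace ℝ (Fin d)) x₀ x) (chartAt (EuclideanSpace ℝ (Fin d)) x₀ y) ≤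
        C * edist x y := by
  obtain ⟨C, hC⟩ := eventually_enorm_mfderiv_chartAt_le (d := d) x₀
  set q := chartAt (EuclideanSpace ℝ (Fin d)) x₀ with hq
  obtain ⟨δ, hδ, hball⟩ := EMetric.mem_nhds_iff.1
    (hC.and (chart_source_mem_nhds (EuclideanSpace ℝ (Fin d)) x₀))
  -- Half of `δ`: a curve of length below `δ / 2` starting within `δ / 2` of `x₀` stays where the
  -- derivative bound holds.
  refine ⟨C, δ / 2, ENNReal.half_pos hδ.ne', fun x hx y hxy => ?_⟩
  have key : ∀ L ∈ Set.Ioo (edist x y) (δ / 2), edist (q x) (q y) ≤ C * L := by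
    rintro L ⟨hL, hLδ⟩
    rw [IsRiemannianManifold.out (I := 𝓡 d) x y] at hL
    obtain ⟨γ, rfl, rfl, γ_smooth, hγ, -⟩ :=
      exists_lt_locally_constant_of_riemannianEDist_lt hL zero_lt_one
    have hmem : ∀ t ∈ Set.Icc (0 : ℝ) 1, γ t ∈ Metric.eball x₀ δ := by
      intro t ht
      have h1 : edist (γ 0) (γ t) ≤ pathELength (𝓡 d) γ 0 1 := by
        rw [IsRiemannianManifold.out (I := 𝓡 d)]
        exact (riemannianEDist_le_pathELength γ_smooth.contMDiffOn rfl rfl ht.1).trans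
          (pathELength_mono le_rfl ht.2)
      calc edist (γ t) x₀ ≤ edist (γ t) (γ 0) + edist (γ 0) x₀ := edist_triangle _ _ _
        _ < δ / 2 + δ / 2 :=
          ENNReal.add_lt_add (by rw [edist_comm]; exact (h1.trans_lt hγ).trans hLδ) hx
        _ = δ := ENNReal.add_halves δ
    have hD : ContMDiffOn 𝓘(ℝ, ℝ) (𝓡 d) 1 (q ∘ γ) (Set.Icc 0 1) :=
      (contMDiffOn_chart (I := 𝓡 d) (n := 1)).comp γ_smooth.contMDiffOn
        (fun t ht => (hball (hmem t ht)).2)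
    calc edist (q (γ 0)) (q (γ 1)) = ‖(q ∘ γ) 1 - (q ∘ γ) 0‖ₑ := by
          rw [edist_comm, edist_eq_enorm_sub]; rfl
      _ ≤ ∫⁻ t in Set.Icc (0 : ℝ) 1, ‖derivWithin (q ∘ γ) (Set.Icc 0 1) t‖ₑ :=
          enorm_sub_le_lintegral_derivWithin_Icc_of_contDiffOn_Icc
            (contMDiffOn_iff_contDiffOn.1 hD) zero_le_one
      _ ≤ ∫⁻ t in Set.Icc (0 : ℝ) 1,
            C * ‖mfderivWithin 𝓘(ℝ, ℝ) (𝓡 d) γ (Set.Icc 0 1) t (1 : ℝ)‖ₑ := by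
          refine setLIntegral_mono' measurableSet_Icc fun t ht => ?_
          have h1 : mfderivWithin 𝓘(ℝ, ℝ) (𝓡 d) (q ∘ γ) (Set.Icc 0 1) t =
              (mfderiv (𝓡 d) (𝓡 d) q (γ t)).comp
                (mfderivWithin 𝓘(ℝ, ℝ) (𝓡 d) γ (Set.Icc 0 1) t) := by
            apply mfderiv_comp_mfderivWithin
            · exact (mdifferentiable_chart x₀).mdifferentiableAt (hball (hmem t ht)).2
            · exact (γ_smooth.mdifferentiable one_ne_zero).mdifferentiableOn _ ht
            · rw [uniqueMDiffWithinAt_iff_uniqueDiffWithinAt]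
              exact uniqueDiffOn_Icc zero_lt_one _ ht
          have h2 : derivWithin (q ∘ γ) (Set.Icc 0 1) t = mfderiv (𝓡 d) (𝓡 d) q (γ t)
              (mfderivWithin 𝓘(ℝ, ℝ) (𝓡 d) γ (Set.Icc 0 1) t (1 : ℝ)) := by
            rw [← fderivWithin_derivWithin, ← mfderivWithin_eq_fderivWithin]
            exact congr($h1 (1 : ℝ))
          rw [h2]
          exact (hball (hmem t ht)).1 _
      _ = C * pathELength (𝓡 d) γ 0 1 := by
          rw [lintegral_const_mul' _ _ ENNReal.coe_ne_top,
            pathELength_eq_lintegral_mfderivWithin_Icc]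
          rfl
      _ ≤ C * L := by gcongr
  -- Near-minimal curves give the bound for every `L` slightly above the distance; let `L` decrease
  -- to it.
  have hne : (𝓝[>] edist x y).NeBot := nhdsGT_neBot_of_exists_gt ⟨_, hxy⟩
  refine ge_of_tendsto (f := fun L => (C : ℝ≥0∞) * L) (x := 𝓝[>] edist x y) ?_
    (Filter.eventually_of_mem (Ioo_mem_nhdsGT hxy) key)
  exact (ENNReal.Tendsto.const_mul Filter.tendsto_id (.inr ENNReal.coe_ne_top)).mono_left
    nhdsWithin_le_nhds

end Riemannian

/-! ### Gram determinants -/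

section Gram

variable {d : ℕ} {V : Type*} [NormedAddCommGroup V] [InnerProductSpace ℝ V]

/-- The Gram matrix of a family of vectors. -/
noncomputable def gramMatrix (v : Fin d → V) : Matrix (Fin d) (Fin d) ℝ :=
  Matrix.of fun i j => inner ℝ (v i) (v j)

theorem isHermitian_gramMatrix (v : Fin d → V) : (gramMatrix v).IsHermitian := by
  ext i j
  simp [gramMatrix, real_inner_comm]

theorem dotProduct_gramMatrix_mulVec (v : Fin d → V) (c : Fin d → ℝ) :
    c ⬝ᵥ (gramMatrix v).mulVec c = ‖∑ i, c i • v i‖ ^ 2 := by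
  rw [← real_inner_self_eq_norm_sq, sum_inner]
  simp only [dotProduct, Matrix.mulVec, gramMatrix, Matrix.of_apply, inner_sum, inner_smul_left,
    inner_smul_right, Finset.mul_sum]
  refine Finset.sum_congr rfl fun i _ => Finset.sum_congr rfl fun j _ => ?_
  simp only [conj_trivial]
  ring

/-- Diagonalize: for a unit eigenvector `b` of the Gram matrix `G`, the eigenvalue is `bᵀ G b = ‖L
b‖²`. Norm bounds on `L` thus become determinant bounds. -/
theorem exists_det_gramMatrix_eq_prod (L : EuclideanSpace ℝ (Fin d) →ₗ[ℝ] V) :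
    ∃ b : Fin d → EuclideanSpace ℝ (Fin d), (∀ i, ‖b i‖ = 1) ∧
      (gramMatrix fun i => L (EuclideanSpace.single i 1)).det = ∏ i, ‖L (b i)‖ ^ 2 := by
  set v := fun i => L (EuclideanSpace.single i 1)
  have hG := isHermitian_gramMatrix v
  refine ⟨hG.eigenvectorBasis, fun i => hG.eigenvectorBasis.norm_eq_one i, ?_⟩
  rw [hG.det_eq_prod_eigenvalues]
  refine Finset.prod_congr rfl fun i _ => ?_
  rw [hG.eigenvalues_eq]
  simp only [star_trivial, RCLike.re_to_real, RCLike.ofReal_real_eq_id, id_eq]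
  rw [dotProduct_gramMatrix_mulVec]
  congr 2
  conv_rhs => rw [← (EuclideanSpace.basisFun (Fin d) ℝ).sum_repr (hG.eigenvectorBasis i), map_sum]
  simp [v]

theorem det_gramMatrix_le {L : EuclideanSpace ℝ (Fin d) →ₗ[ℝ] V} {C : ℝ}
    (h : ∀ v, ‖L v‖ ≤ C * ‖v‖) :
    (gramMatrix fun i => L (EuclideanSpace.single i 1)).det ≤ (C ^ 2) ^ d := by
  obtain ⟨b, hb, hdet⟩ := exists_det_gramMatrix_eq_prod L
  rw [hdet]
  refine (Finset.prod_le_prod (g := fun _ => C ^ 2) (fun i _ => by positivity) fun i _ => ?_).trans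
    (by simp)
  gcongr
  simpa [hb] using h (b i)

theorem le_det_gramMatrix {L : EuclideanSpace ℝ (Fin d) →ₗ[ℝ] V} {K : ℝ} (hK : 0 ≤ K)
    (h : ∀ v, K * ‖v‖ ≤ ‖L v‖) :
    (K ^ 2) ^ d ≤ (gramMatrix fun i => L (EuclideanSpace.single i 1)).det := by
  obtain ⟨b, hb, hdet⟩ := exists_det_gramMatrix_eq_prod L
  rw [hdet]
  refine le_trans (by simp) (Finset.prod_le_prod (f := fun _ => K ^ 2) (fun i _ => by positivity)
    fun i _ => ?_)
  gcongr
  simpa [hb] using h (b i)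

/-- If `A` is the matrix of `J`, the Gram matrix `G` becomes `Aᵀ G A`. -/
theorem det_gramMatrix_comp (L : EuclideanSpace ℝ (Fin d) →ₗ[ℝ] V)
    (J : EuclideanSpace ℝ (Fin d) →ₗ[ℝ] EuclideanSpace ℝ (Fin d)) :
    (gramMatrix fun i => L (J (EuclideanSpace.single i 1))).det =
      LinearMap.det J ^ 2 * (gramMatrix fun i => L (EuclideanSpace.single i 1)).det := by
  set e := (EuclideanSpace.basisFun (Fin d) ℝ).toBasis with he
  set A := LinearMap.toMatrix e e J with hA
  have hJ : ∀ i, L (J (EuclideanSpace.single i 1)) =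
      ∑ k, A k i • L (EuclideanSpace.single k 1) := by
    intro i
    have h1 : J (EuclideanSpace.single i 1) = ∑ k, A k i • EuclideanSpace.single k (1 : ℝ) := by
      conv_lhs => rw [← (EuclideanSpace.basisFun (Fin d) ℝ).sum_repr (J _)]
      simp [hA, he, LinearMap.toMatrix_apply]
    rw [h1, map_sum]
    simp
  have hmat : (gramMatrix fun i => L (J (EuclideanSpace.single i 1))) =
      A.transpose * (gramMatrix fun i => L (EuclideanSpace.single i 1)) * A := by
    ext i j
    simp only [gramMatrix, Matrix.of_apply, hJ, sum_inner, inner_sum, inner_smul_left,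
      inner_smul_right, conj_trivial, Matrix.mul_apply, Matrix.transpose_apply, Finset.sum_mul,
      Finset.mul_sum]
    refine Finset.sum_congr rfl fun k _ => Finset.sum_congr rfl fun l _ => by ring
  rw [hmat, Matrix.det_mul, Matrix.det_mul, Matrix.det_transpose, hA, LinearMap.det_toMatrix]
  ring

end Gram

/-! ### Metric determinant under change of charts -/

section Transition

/-- The two charts express the base point by different terms, so the inner products live on fibres
that are only propositionally the same; `h` bridges them. -/
theorem det_gramMatrix_tangent_comp {d : ℕ} {M : Type*} [EMetricSpace M]
    [ChartedSpace (EuclideanSpace ℝ (Fin d)) M]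
    [RiemannianBundle (fun x : M => TangentSpace (𝓡 d) x)] {a b : M} (h : a = b)
    (L : EuclideanSpace ℝ (Fin d) →L[ℝ] EuclideanSpace ℝ (Fin d))
    (J : EuclideanSpace ℝ (Fin d) →L[ℝ] EuclideanSpace ℝ (Fin d)) :
    (gramMatrix (V := TangentSpace (𝓡 d) a) fun i => L (J (EuclideanSpace.single i 1))).det =
      J.det ^ 2 *
        (gramMatrix (V := TangentSpace (𝓡 d) b) fun i => L (EuclideanSpace.single i 1)).det := by
  subst h
  let L' : EuclideanSpace ℝ (Fin d) →L[ℝ] TangentSpace (𝓡 d) a := L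
  exact det_gramMatrix_comp L'.toLinearMap J.toLinearMap

variable {d : ℕ} {M : Type*} [EMetricSpace M] [ChartedSpace (EuclideanSpace ℝ (Fin d)) M]
  [IsManifold (𝓡 d) ∞ M]

/-- The transition map between two charts is differentiable. -/
theorem differentiableAt_transition (p q : M) {y : EuclideanSpace ℝ (Fin d)}
    (hy : y ∈ (chartAt (EuclideanSpace ℝ (Fin d)) p).target)
    (hyq : (chartAt (EuclideanSpace ℝ (Fin d)) p).symm y ∈
      (chartAt (EuclideanSpace ℝ (Fin d)) q).source) :
    DifferentiableAt ℝ (chartAt (EuclideanSpace ℝ (Fin d)) q ∘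
      (chartAt (EuclideanSpace ℝ (Fin d)) p).symm) y := by
  rw [← mdifferentiableAt_iff_differentiableAt]
  exact ((mdifferentiable_chart (I := 𝓡 d) q).mdifferentiableAt hyq).comp y
    ((mdifferentiable_chart (I := 𝓡 d) p).mdifferentiableAt_symm hy)

variable [RiemannianBundle (fun x : M => TangentSpace (𝓡 d) x)]

/-- Chain rule for `P.symm = Q.symm ∘ (Q ∘ P.symm)` near `y`, then the Gram formula. -/
theorem det_metricCoeff_transition (p q : M) {y : EuclideanSpace ℝ (Fin d)}
    (hy : y ∈ (chartAt (EuclideanSpace ℝ (Fin d)) p).target)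
    (hyq : (chartAt (EuclideanSpace ℝ (Fin d)) p).symm y ∈
      (chartAt (EuclideanSpace ℝ (Fin d)) q).source) :
    (metricCoeff p y).det = (fderiv ℝ (chartAt (EuclideanSpace ℝ (Fin d)) q ∘
      (chartAt (EuclideanSpace ℝ (Fin d)) p).symm) y).det ^ 2 *
        (metricCoeff q (chartAt (EuclideanSpace ℝ (Fin d)) q
          ((chartAt (EuclideanSpace ℝ (Fin d)) p).symm y))).det := by
  have hd := differentiableAt_transition p q hy hyq
  set P := chartAt (EuclideanSpace ℝ (Fin d)) p with hP
  set Q := chartAt (EuclideanSpace ℝ (Fin d)) q with hQ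
  have hev : (P.symm : EuclideanSpace ℝ (Fin d) → M) =ᶠ[𝓝 y] Q.symm ∘ (Q ∘ P.symm) := by
    filter_upwards [(P.isOpen_inter_preimage_symm Q.open_source).mem_nhds ⟨hy, hyq⟩] with z hz
    exact (Q.left_inv hz.2).symm
  have h1 : mfderiv (𝓡 d) (𝓡 d) P.symm y =
      (mfderiv (𝓡 d) (𝓡 d) Q.symm (Q (P.symm y))).comp (fderiv ℝ (Q ∘ P.symm) y) := by
    rw [← mfderiv_eq_fderiv]
    refine hev.mfderiv_eq.trans ?_
    exact mfderiv_comp y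
      ((mdifferentiable_chart (I := 𝓡 d) q).mdifferentiableAt_symm (Q.map_source hyq))
      hd.mdifferentiableAt
  have h2 := det_gramMatrix_tangent_comp (Q.left_inv hyq).symm
    (mfderiv (𝓡 d) (𝓡 d) Q.symm (Q (P.symm y))) (fderiv ℝ (Q ∘ P.symm) y)
  refine Eq.trans ?_ h2
  congr 1
  ext i j
  simp only [metricCoeff, gramMatrix, Matrix.of_apply, coordVector]
  rw [h1]
  rfl

end Transition

/-! ### Local bounds on the volume density -/

section Density

variable {d : ℕ} {M : Type*} [EMetricSpace M] [ChartedSpace (EuclideanSpace ℝ (Fin d)) M]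
  [IsManifold (𝓡 d) ∞ M] [RiemannianBundle (fun x : M => TangentSpace (𝓡 d) x)]
  [IsContMDiffRiemannianBundle (𝓡 d) ∞ (EuclideanSpace ℝ (Fin d))
    (fun x : M => TangentSpace (𝓡 d) x)]

theorem eventually_sqrt_det_metricCoeff_le (x₀ : M) :
    ∃ D : ℝ, ∀ᶠ y in 𝓝 (chartAt (EuclideanSpace ℝ (Fin d)) x₀ x₀),
      Real.sqrt (metricCoeff x₀ y).det ≤ D := by
  obtain ⟨C, hC⟩ := eventually_enorm_mfderiv_chartAt_symm_le (d := d) x₀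
  refine ⟨Real.sqrt (((C : ℝ) ^ 2) ^ d), hC.mono fun y hy => Real.sqrt_le_sqrt ?_⟩
  let L : EuclideanSpace ℝ (Fin d) →L[ℝ]
      TangentSpace (𝓡 d) ((chartAt (EuclideanSpace ℝ (Fin d)) x₀).symm y) :=
    mfderiv (𝓡 d) (𝓡 d) (chartAt (EuclideanSpace ℝ (Fin d)) x₀).symm y
  refine det_gramMatrix_le (L := L.toLinearMap) fun v => ?_
  have := hy v
  simp only [enorm_eq_nnnorm] at this
  exact_mod_cast this

theorem eventually_le_sqrt_det_metricCoeff (x₀ : M) :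
    ∃ D : ℝ, 0 < D ∧ ∀ᶠ y in 𝓝 (chartAt (EuclideanSpace ℝ (Fin d)) x₀ x₀),
      D ≤ Real.sqrt (metricCoeff x₀ y).det := by
  obtain ⟨C, hC⟩ := eventually_enorm_mfderiv_chartAt_le (d := d) x₀
  set q := chartAt (EuclideanSpace ℝ (Fin d)) x₀ with hq
  have hmem : x₀ ∈ q.source := mem_chart_source _ x₀
  have hcont : Filter.Tendsto q.symm (𝓝 (q x₀)) (𝓝 x₀) := by
    simpa only [ContinuousAt, q.left_inv hmem] using q.continuousAt_symm (q.map_source hmem)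
  -- The chart derivative inverts that of its inverse, so its upper bound `C` gives a lower one; `C
  -- + 1` avoids inverting zero.
  refine ⟨Real.sqrt ((((C + 1 : ℝ)⁻¹) ^ 2) ^ d), by positivity, ?_⟩
  filter_upwards [hcont.eventually hC, q.open_target.mem_nhds (q.map_source hmem)] with y hy hyt
  refine Real.sqrt_le_sqrt ?_
  let L : EuclideanSpace ℝ (Fin d) →L[ℝ] TangentSpace (𝓡 d) (q.symm y) :=
    mfderiv (𝓡 d) (𝓡 d) q.symm y
  refine le_det_gramMatrix (L := L.toLinearMap) (by positivity) fun v => ?_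
  have h1 := hy (L v)
  have h2 : mfderiv (𝓡 d) (𝓡 d) q (q.symm y) (L v) = v :=
    congr($((mdifferentiable_chart (I := 𝓡 d) x₀).comp_symm_deriv hyt) v)
  rw [h2] at h1
  have h3 : ‖v‖ ≤ C * ‖L v‖ := by
    simp only [enorm_eq_nnnorm] at h1
    exact_mod_cast h1
  rw [inv_mul_le_iff₀ (by positivity)]
  refine h3.trans ?_
  change C * ‖L v‖ ≤ (C + 1) * ‖L v‖
  gcongr
  linarith

end Density

/-! ### Compatibility of chart volumes -/

section ChartVolume

variable {d : ℕ} {M : Type*} [EMetricSpace M] [ChartedSpace (EuclideanSpace ℝ (Fin d)) M]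
  [MeasurableSpace M] [BorelSpace M]

theorem measurableSet_chartAt_symm_preimage_inter (p : M) {A : Set M} (hA : MeasurableSet A) :
    MeasurableSet ((chartAt (EuclideanSpace ℝ (Fin d)) p).symm ⁻¹' A ∩
      (chartAt (EuclideanSpace ℝ (Fin d)) p).target) := by
  classical
  set P := chartAt (EuclideanSpace ℝ (Fin d)) p with hP
  -- `P.symm` is controlled only on the target; replacing it by a constant elsewhere makes it
  -- measurable.
  have h := P.continuousOn_symm.measurable_piecewise (g := fun _ => p) continuousOn_const
    P.open_target.measurableSet
  convert (h hA).inter P.open_target.measurableSet using 1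
  ext y
  refine and_congr_left fun hy => ?_
  simp [Set.piecewise_eq_of_mem _ _ _ hy]

variable [RiemannianBundle (fun x : M => TangentSpace (𝓡 d) x)]

theorem chartVolume_apply (p : M) {A : Set M} (hA : MeasurableSet A) :
    chartVolume (d := d) p A = ∫⁻ y in (chartAt (EuclideanSpace ℝ (Fin d)) p).symm ⁻¹' A ∩
      (chartAt (EuclideanSpace ℝ (Fin d)) p).target,
        ENNReal.ofReal (Real.sqrt (metricCoeff p y).det) := by
  set P := chartAt (EuclideanSpace ℝ (Fin d)) p with hP
  have hm : AEMeasurable P.symm ((volume : Measure (EuclideanSpace ℝ (Fin d))).restrict P.target) :=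
    P.continuousOn_symm.aemeasurable P.open_target.measurableSet
  rw [chartVolume, Measure.map_apply_of_aemeasurable
    (hm.mono_ac (withDensity_absolutelyContinuous _ _)) hA, withDensity_apply',
    Measure.restrict_restrict' P.open_target.measurableSet]

theorem chartVolume_inter_source (p : M) {A : Set M} (hA : MeasurableSet A) :
    chartVolume (d := d) p A =
      chartVolume (d := d) p (A ∩ (chartAt (EuclideanSpace ℝ (Fin d)) p).source) := by
  set P := chartAt (EuclideanSpace ℝ (Fin d)) p with hP
  rw [chartVolume_apply p hA, chartVolume_apply p (hA.inter P.open_source.measurableSet)]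
  congr 2
  ext y
  exact and_congr_left fun hy => ⟨fun h => ⟨h, P.map_target hy⟩, fun h => h.1⟩

variable [IsManifold (𝓡 d) ∞ M]

/-- The chart volumes agree on overlaps of chart domains. -/
theorem chartVolume_eq_of_subset (p q : M) {A : Set M} (hA : MeasurableSet A)
    (hp : A ⊆ (chartAt (EuclideanSpace ℝ (Fin d)) p).source)
    (hq : A ⊆ (chartAt (EuclideanSpace ℝ (Fin d)) q).source) :
    chartVolume (d := d) p A = chartVolume (d := d) q A := by
  have hS := measurableSet_chartAt_symm_preimage_inter (d := d) p hA
  rw [chartVolume_apply p hA, chartVolume_apply q hA]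
  have hdet := fun y => det_metricCoeff_transition (d := d) p q (y := y)
  have hdiff := fun y => differentiableAt_transition (d := d) p q (y := y)
  set P := chartAt (EuclideanSpace ℝ (Fin d)) p with hP
  set Q := chartAt (EuclideanSpace ℝ (Fin d)) q with hQ
  have himage : Q.symm ⁻¹' A ∩ Q.target = (Q ∘ P.symm) '' (P.symm ⁻¹' A ∩ P.target) := by
    ext w
    constructor
    · rintro ⟨hw, hwt⟩
      refine ⟨P (Q.symm w), ⟨?_, P.map_source (hp hw)⟩, ?_⟩
      · simpa [P.left_inv (hp hw)] using hw
      · simp [P.left_inv (hp hw), Q.right_inv hwt]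
    · rintro ⟨y, ⟨hy, hyt⟩, rfl⟩
      refine ⟨?_, Q.map_source (hq hy)⟩
      simpa [Q.left_inv (hq hy)] using hy
  have hinj : Set.InjOn (Q ∘ P.symm) (P.symm ⁻¹' A ∩ P.target) :=
    Q.injOn.comp (P.symm.injOn.mono Set.inter_subset_right) fun y hy => hq hy.1
  -- Change of variables: the Jacobian `|det|` matches the square root of the factor `det²` in the
  -- metric determinant.
  rw [himage, lintegral_image_eq_lintegral_abs_det_fderiv_mul volume hS
    (fun y hy => (hdiff y hy.2 (hq hy.1)).hasFDerivAt.hasFDerivWithinAt) hinj]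
  refine setLIntegral_congr_fun hS fun y hy => ?_
  simp only [Function.comp_apply]
  rw [hdet y hy.2 (hq hy.1), Real.sqrt_mul (sq_nonneg _), Real.sqrt_sq_eq_abs,
    ENNReal.ofReal_mul (abs_nonneg _)]

theorem chartVolume_restrict_le (p q : M) :
    (chartVolume (d := d) p).restrict (chartAt (EuclideanSpace ℝ (Fin d)) q).source ≤
      chartVolume (d := d) q := by
  refine Measure.le_iff.2 fun A hA => ?_
  have hQ := (chartAt (EuclideanSpace ℝ (Fin d)) q).open_source.measurableSet
  have hP := (chartAt (EuclideanSpace ℝ (Fin d)) p).open_source.measurableSet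
  rw [Measure.restrict_apply hA, chartVolume_inter_source p (hA.inter hQ),
    chartVolume_eq_of_subset p q ((hA.inter hQ).inter hP) Set.inter_subset_right
      (fun x hx => hx.1.2)]
  exact measure_mono fun x hx => hx.1.1

end ChartVolume

/-- A supremum of measures is not computed setwise, so an upper bound is exhibited: `ν` plus the
supremum restricted to `sᶜ`. Restriction to `s` kills the second term. -/
theorem iSup_restrict_le {α ι : Type*} [MeasurableSpace α] {μ : ι → Measure α} {ν : Measure α}
    {s : Set α} (hs : MeasurableSet s) (h : ∀ i, (μ i).restrict s ≤ ν) :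
    (⨆ i, μ i).restrict s ≤ ν := by
  have h1 : ⨆ i, μ i ≤ ν + (⨆ i, μ i).restrict sᶜ := by
    refine iSup_le fun i => ?_
    rw [← Measure.restrict_add_restrict_compl (μ := μ i) hs]
    exact add_le_add (h i) (Measure.restrict_mono le_rfl (le_iSup μ i))
  refine (Measure.restrict_mono le_rfl h1).trans ?_
  rw [Measure.restrict_add, Measure.restrict_restrict hs, Set.inter_compl_self,
    Measure.restrict_empty, add_zero]
  exact Measure.restrict_le_self

/-! ### Ball growth for the Riemannian volume -/

section Volume

variable {d : ℕ} {M : Type*} [EMetricSpace M] [ChartedSpace (EuclideanSpace ℝ (Fin d)) M]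
  [IsManifold (𝓡 d) ∞ M] [RiemannianBundle (fun x : M => TangentSpace (𝓡 d) x)]
  [MeasurableSpace M] [BorelSpace M]

theorem riemannianVolume_le_chartVolume (q : M) {A : Set M}
    (hA : A ⊆ (chartAt (EuclideanSpace ℝ (Fin d)) q).source) :
    riemannianVolume d M A ≤ chartVolume (d := d) q A := by
  rw [← Measure.restrict_eq_self (riemannianVolume d M) hA]
  exact iSup_restrict_le (chartAt (EuclideanSpace ℝ (Fin d)) q).open_source.measurableSet
    (fun p => chartVolume_restrict_le p q) A

variable [IsContMDiffRiemannianBundle (𝓡 d) ∞ (EuclideanSpace ℝ (Fin d))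
  (fun x : M => TangentSpace (𝓡 d) x)]

/-- Needed for the normalization to give mass one; a positive density on a small open set suffices.
-/
theorem riemannianVolume_univ_ne_zero [Nonempty M] : riemannianVolume d M Set.univ ≠ 0 := by
  obtain ⟨x₀⟩ := ‹Nonempty M›
  obtain ⟨D, hD, hev⟩ := eventually_le_sqrt_det_metricCoeff (d := d) x₀
  set q := chartAt (EuclideanSpace ℝ (Fin d)) x₀ with hq
  obtain ⟨U, hU, hUo, hxU⟩ := mem_nhds_iff.1
    (Filter.inter_mem hev (q.open_target.mem_nhds (q.map_source (mem_chart_source _ x₀))))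
  refine ne_of_gt ?_
  calc 0 < ENNReal.ofReal D * volume U :=
        ENNReal.mul_pos (by simpa using hD) (hUo.measure_pos volume ⟨_, hxU⟩).ne'
    _ = ∫⁻ _ in U, ENNReal.ofReal D := by simp
    _ ≤ ∫⁻ y in U, ENNReal.ofReal (Real.sqrt (metricCoeff x₀ y).det) :=
        setLIntegral_mono' hUo.measurableSet fun y hy => ENNReal.ofReal_le_ofReal (hU hy).1
    _ ≤ ∫⁻ y in q.symm ⁻¹' Set.univ ∩ q.target,
          ENNReal.ofReal (Real.sqrt (metricCoeff x₀ y).det) :=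
        lintegral_mono_set fun y hy => ⟨trivial, (hU hy).2⟩
    _ = chartVolume (d := d) x₀ Set.univ := (chartVolume_apply x₀ MeasurableSet.univ).symm
    _ ≤ riemannianVolume d M Set.univ :=
        le_iSup (fun p : M => chartVolume (d := d) p) x₀ Set.univ

variable [IsRiemannianManifold (𝓡 d) M]

/-- Small balls near `x₀` of radius `r` have volume at most a multiple of `r ^ d`. -/
theorem exists_riemannianVolume_eball_le (x₀ : M) :
    ∃ K : ℝ≥0, ∃ ε : ℝ, 0 < ε ∧ ∀ x ∈ Metric.eball x₀ (ENNReal.ofReal ε), ∀ r : ℝ, 0 < r → r ≤ ε →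
      riemannianVolume d M (Metric.eball x (ENNReal.ofReal r)) ≤ K * ENNReal.ofReal (r ^ d) := by
  obtain ⟨D, hD⟩ := eventually_sqrt_det_metricCoeff_le (d := d) x₀
  obtain ⟨C, ε₁, hε₁, hC⟩ := exists_edist_chartAt_le (d := d) x₀
  set q := chartAt (EuclideanSpace ℝ (Fin d)) x₀ with hq
  have hmem : x₀ ∈ q.source := mem_chart_source _ x₀
  obtain ⟨δ, hδ, hball⟩ := EMetric.mem_nhds_iff.1
    (((q.continuousAt hmem).eventually hD).and (q.open_source.mem_nhds hmem))
  -- Below `ε₁` the chart is Lipschitz; below `δ / 2` the balls stay in the region of bounded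
  -- density.
  obtain ⟨ε, hε0, hε⟩ := ENNReal.lt_iff_exists_nnreal_btwn.1
    (lt_min hε₁ (ENNReal.half_pos hδ.ne'))
  have hB : volume (Metric.ball (0 : EuclideanSpace ℝ (Fin d)) 1) ≠ ⊤ := measure_ball_lt_top.ne
  refine ⟨D.toNNReal * (C ^ d * (volume (Metric.ball (0 : EuclideanSpace ℝ (Fin d)) 1)).toNNReal),
    ε, by exact_mod_cast hε0, fun x hx r hr hrε => ?_⟩
  rw [ENNReal.ofReal_coe_nnreal] at hx
  have hr' : ENNReal.ofReal r ≤ ε := by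
    rw [← ENNReal.ofReal_coe_nnreal]; exact ENNReal.ofReal_le_ofReal hrε
  have hsub : Metric.eball x (ENNReal.ofReal r) ⊆ Metric.eball x₀ δ := fun y hy => by
    calc edist y x₀ ≤ edist y x + edist x x₀ := edist_triangle _ _ _
      _ < δ / 2 + δ / 2 := ENNReal.add_lt_add
          (lt_of_lt_of_le hy (hr'.trans (hε.le.trans (min_le_right _ _))))
          (lt_of_lt_of_le hx (hε.le.trans (min_le_right _ _)))
      _ = δ := ENNReal.add_halves δ
  set A := Metric.eball x (ENNReal.ofReal r)
  have hAm : MeasurableSet A := Metric.isOpen_eball.measurableSet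
  have hS := measurableSet_chartAt_symm_preimage_inter (d := d) x₀ hAm
  -- A closed ball, since `C` may be zero.
  have hSball : q.symm ⁻¹' A ∩ q.target ⊆ Metric.closedBall (q x) (C * r) := by
    rintro y ⟨hy, hyt⟩
    have hy' : edist x (q.symm y) < ENNReal.ofReal r := by rw [edist_comm]; exact hy
    have h1 := hC x (lt_of_lt_of_le hx (hε.le.trans (min_le_left _ _))) (q.symm y)
      (hy'.trans_le (hr'.trans (hε.le.trans (min_le_left _ _))))
    rw [q.right_inv hyt] at h1
    have h2 : edist (q x) y ≤ ENNReal.ofReal (C * r) := by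
      rw [ENNReal.ofReal_mul C.coe_nonneg, ENNReal.ofReal_coe_nnreal]
      exact h1.trans (by gcongr)
    rw [edist_dist, ENNReal.ofReal_le_ofReal_iff (by positivity)] at h2
    rwa [Metric.mem_closedBall, dist_comm]
  calc riemannianVolume d M A ≤ chartVolume (d := d) x₀ A :=
        riemannianVolume_le_chartVolume x₀ fun y hy => (hball (hsub hy)).2
    _ = ∫⁻ y in q.symm ⁻¹' A ∩ q.target, ENNReal.ofReal (Real.sqrt (metricCoeff x₀ y).det) :=
        chartVolume_apply x₀ hAm
    _ ≤ ∫⁻ _ in q.symm ⁻¹' A ∩ q.target, ENNReal.ofReal D := by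
        refine setLIntegral_mono' hS fun y hy => ENNReal.ofReal_le_ofReal ?_
        have h1 := (hball (hsub hy.1)).1
        rwa [q.right_inv hy.2] at h1
    _ = ENNReal.ofReal D * volume (q.symm ⁻¹' A ∩ q.target) := by simp
    _ ≤ ENNReal.ofReal D * volume (Metric.closedBall (q x) (C * r)) := by gcongr
    _ = _ := by
        rw [Measure.addHaar_closedBall _ _ (by positivity), finrank_euclideanSpace_fin, mul_pow,
          ENNReal.ofReal_mul (by positivity), ENNReal.coe_mul, ENNReal.coe_mul,
          ENNReal.coe_toNNReal hB, ENNReal.ofReal_pow C.coe_nonneg, ENNReal.ofReal_coe_nnreal,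
          ENNReal.coe_pow]
        change (D.toNNReal : ℝ≥0∞) * _ = _
        ring

variable [CompactSpace M]

theorem exists_forall_riemannianVolume_eball_le :
    ∃ K : ℝ≥0, ∃ ε : ℝ, 0 < ε ∧ ∀ x : M, ∀ r : ℝ, 0 < r → r ≤ ε →
      riemannianVolume d M (Metric.eball x (ENNReal.ofReal r)) ≤ K * ENNReal.ofReal (r ^ d) := by
  suffices h : ∃ K : ℝ≥0, ∃ ε : ℝ, 0 < ε ∧ ∀ x ∈ (Set.univ : Set M), ∀ r : ℝ, 0 < r → r ≤ ε →
      riemannianVolume d M (Metric.eball x (ENNReal.ofReal r)) ≤ K * ENNReal.ofReal (r ^ d) by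
    simpa using h
  refine isCompact_univ.induction_on (p := fun s : Set M => ∃ K : ℝ≥0, ∃ ε : ℝ, 0 < ε ∧
    ∀ x ∈ s, ∀ r : ℝ, 0 < r → r ≤ ε → riemannianVolume d M (Metric.eball x (ENNReal.ofReal r)) ≤
      K * ENNReal.ofReal (r ^ d)) ?_ ?_ ?_ ?_
  · exact ⟨0, 1, one_pos, by simp⟩
  · rintro s t hst ⟨K, ε, hε, h⟩
    exact ⟨K, ε, hε, fun x hx => h x (hst hx)⟩
  · rintro s t ⟨K, ε, hε, h⟩ ⟨K', ε', hε', h'⟩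
    refine ⟨max K K', min ε ε', lt_min hε hε', ?_⟩
    rintro x (hx | hx) r hr hrε
    · refine (h x hx r hr (hrε.trans (min_le_left _ _))).trans ?_
      gcongr
      exact le_max_left _ _
    · refine (h' x hx r hr (hrε.trans (min_le_right _ _))).trans ?_
      gcongr
      exact le_max_right _ _
  · intro x₀ _
    obtain ⟨K, ε, hε, h⟩ := exists_riemannianVolume_eball_le (d := d) x₀
    exact ⟨_, mem_nhdsWithin_of_mem_nhds (Metric.eball_mem_nhds x₀ (by simpa using hε)), K, ε, hε, h⟩

instance isFiniteMeasure_riemannianVolume : IsFiniteMeasure (riemannianVolume d M) := by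
  obtain ⟨K, ε, hε, h⟩ := exists_forall_riemannianVolume_eball_le (d := d) (M := M)
  have : IsLocallyFiniteMeasure (riemannianVolume d M) :=
    ⟨fun x => ⟨_, Metric.eball_mem_nhds x (by simpa using hε),
      (h x ε hε le_rfl).trans_lt (ENNReal.mul_lt_top ENNReal.coe_lt_top ENNReal.ofReal_lt_top)⟩⟩
  infer_instance

instance isProbabilityMeasure_normalizedVolume [Nonempty M] :
    IsProbabilityMeasure (normalizedVolume d M) :=
  ⟨ENNReal.inv_mul_cancel riemannianVolume_univ_ne_zero (measure_ne_top _ _)⟩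

theorem exists_normalizedVolume_eball_le [Nonempty M] :
    ∃ C : ℝ, 1 ≤ C ∧ ∀ x : M, ∀ r : ℝ, 0 < r →
      normalizedVolume d M (Metric.eball x (ENNReal.ofReal r)) ≤ ENNReal.ofReal (C * r ^ d) := by
  obtain ⟨K, ε, hε, h⟩ := exists_forall_riemannianVolume_eball_le (d := d) (M := M)
  set V := (riemannianVolume d M Set.univ)⁻¹ with hV
  have hVtop : V ≠ ⊤ := ENNReal.inv_ne_top.2 riemannianVolume_univ_ne_zero
  -- The three entries serve `1 ≤ C`, radii up to `ε`, and larger radii, where the mass is at most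
  -- `1 ≤ (r / ε)^d`.
  refine ⟨max 1 (max (V.toReal * K) ((1 / ε) ^ d)), le_max_left _ _, fun x r hr => ?_⟩
  rcases le_or_gt r ε with hrε | hrε
  · calc normalizedVolume d M (Metric.eball x (ENNReal.ofReal r))
        = V * riemannianVolume d M (Metric.eball x (ENNReal.ofReal r)) := rfl
      _ ≤ V * (K * ENNReal.ofReal (r ^ d)) := by gcongr; exact h x r hr hrε
      _ = ENNReal.ofReal (V.toReal * K * r ^ d) := by
          rw [ENNReal.ofReal_mul (by positivity), ENNReal.ofReal_mul (by positivity),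
            ENNReal.ofReal_toReal hVtop, ENNReal.ofReal_coe_nnreal, mul_assoc]
      _ ≤ _ := by
          gcongr
          exact (le_max_left _ _).trans (le_max_right _ _)
  · calc normalizedVolume d M (Metric.eball x (ENNReal.ofReal r)) ≤ 1 := prob_le_one
      _ ≤ ENNReal.ofReal ((1 / ε) ^ d * r ^ d) := by
          rw [← mul_pow, ENNReal.one_le_ofReal]
          exact one_le_pow₀ (by rw [one_div_mul_eq_div, one_le_div hε]; exact hrε.le)
      _ ≤ _ := by
          gcongr
          exact (le_max_right _ _).trans (le_max_right _ _)

end Volume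

end SignedTransport

theorem mainTheorem5 {d : ℕ} (hd : 1 ≤ d) {M : Type*} [EMetricSpace M] [CompactSpace M]
    [Nonempty M] [ChartedSpace (EuclideanSpace ℝ (Fin d)) M] [IsManifold (𝓡 d) ∞ M]
    [RiemannianBundle (fun x : M => TangentSpace (𝓡 d) x)]
    [IsContMDiffRiemannianBundle (𝓡 d) ∞ (EuclideanSpace ℝ (Fin d))
      (fun x : M => TangentSpace (𝓡 d) x)]
    [IsRiemannianManifold (𝓡 d) M] [MeasurableSpace M] [BorelSpace M] :
    ∃ c : ℝ, 0 < c ∧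
      (∀ (N : ℕ), 0 < N → ∀ z : Fin N → M,
        ENNReal.ofReal (c / (N : ℝ) ^ (1 / (d : ℝ))) ≤
          SignedTransport.W₁ (SignedTransport.empirical z)
            (SignedTransport.normalizedVolume d M)) ∧
      (∀ (N₁ N₂ : ℕ), 0 < N₁ + N₂ → ∀ (x : Fin N₁ → M) (y : Fin N₂ → M),
        ENNReal.ofReal (c / ((N₁ : ℝ) + (N₂ : ℝ)) ^ (1 / (d : ℝ))
            - 2 * (N₂ : ℝ) / ((N₁ : ℝ) + (N₂ : ℝ))) ≤
          SignedTransport.signedW₁ (SignedTransport.signedEmpirical x y)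
            (SignedTransport.normalizedVolume d M).toSignedMeasure) := by
  obtain ⟨C, hC, hball⟩ := SignedTransport.exists_normalizedVolume_eball_le (d := d) (M := M)
  exact SignedTransport.exists_transport_lower_bound hd hC hball
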